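/- Setting. An episodic MDP with finite state space $\mathcal S$, finite action space $\mathcal A$, horizon $H$ and fixed initial state $s_1$ has transition laws $\mathbb P_{\mathcal M,h}(\cdot\mid s,a)$ and reward laws $R_{\mathcal M,h}(s,a)$ that are $1$-subgaussian with nonnegative means, the total mean reward along every trajectory of positive probability being at most $1$. For a policy $\pi=(\pi_h)_{h\le H}$, $\pi_h:\mathcal S\to\Delta(\mathcal A)$, let $V_{\mathcal M}^{\pi}$ be its value from $s_1$. A pre-training and fine-tuning algorithm $\mathrm{Alg}$ first draws i.i.d. instances, as many as it likes, from a distribution $\mathbb D$ over MDPs, and may inspect or interact with them in any way. In the test stage an unknown instance $\mathcal M^*\sim\mathbb D$ is drawn independently and kept fixed for $K$ episodes; in episode $k$ the algorithm deploys a policy $\pi_k$ chosen, possibly at random, from the outcome of pre-training, the policies deployed before and the trajectories (states, actions, rewards) observed in the previous test episodes. Put $$\operatorname{Reg}_K(\mathbb D,\mathrm{Alg})=\mathbb E_{\mathcal M^*\sim\mathbb D}\,\mathbb E\sum_{k=1}^K\Big[\max_{\pi}V_{\mathcal M^*}^{\pi}-V_{\mathcal M^*}^{\pi_k}\Big],\qquad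 \mathcal C(\mathbb D)=\min\big\{|\tilde\Omega| : \Pr_{\mathcal M\sim\mathbb D}[\mathcal M\in\tilde\Omega]\ge 1-1/\sqrt K\big\}.$$ Theorem. There is a universal constant $c>0$ such that for all integers $M\ge 2$ and $K\ge 5$ there are a number $\Delta\in(0,1/2]$ and a class $\Omega=\{\nu_1,\dots,\nu_M\}$ of $M$ distinct such MDPs, where $\nu_i$ is the $M$-armed bandit (one state, $H=1$) in which the reward of arm $j$ is Gaussian with unit variance and mean $\frac12+\Delta\,\mathbb I\{i=j\}$, with the following property. For every pre-training and fine-tuning algorithm $\mathrm{Alg}$ there is a distribution $\mathbb D$ over $\Omega$, namely the uniform one, such that $$\operatorname{Reg}_K(\mathbb D,\mathrm{Alg})\ \ge\ c\,\min\big(\sqrt{\mathcal C(\mathbb D)\,K},\,K\big).$$ -/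

import Mathlib

open MeasureTheory ProbabilityTheory
open scoped ENNReal

noncomputable section

namespace RLGen

/-! ### Episodic MDPs, policies, values -/

/-- An episodic (tabular) MDP with state space `S`, action space `A` and horizon `H`: transition
laws `P_h(· | s, a)` and reward laws `R_h(s, a)` on the real line. The steps are `0, …, H - 1`. -/
structure EpisodicMDP (S A : Type) (H : ℕ) where
  trans : Fin H → S → A → PMF S
  reward : Fin H → S → A → ProbabilityMeasure ℝ

/-- Instances are distinguishable objects: every set of instances is an event (all distributions
over instances are countably supported). -/
instance (S A : Type) (H : ℕ) : MeasurableSpace (EpisodicMDP S A H) := ⊤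

/-- A (Markov, possibly stochastic) policy: for each step and state a distribution over actions. -/
abbrev Policy (S A : Type) [Fintype A] (H : ℕ) : Type := Fin H → S → stdSimplex ℝ A

variable {S A : Type} [Fintype S] [Fintype A]
  [MeasurableSpace S] [DiscreteMeasurableSpace S] [MeasurableSpace A] [DiscreteMeasurableSpace A]
  {H : ℕ}

/-- The mean reward `r_h(s, a)`. -/
def EpisodicMDP.meanReward {S A : Type} {H : ℕ} (M : EpisodicMDP S A H) (h : Fin H) (s : S)
    (a : A) : ℝ :=
  ∫ x, x ∂(M.reward h s a : Measure ℝ)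

/-- The standing assumptions on instances, with initial state `s₁`: rewards have nonnegative means
and are `1`-subgaussian, and the total mean reward along every state-action trajectory that starts
at `s₁` and only uses transitions of positive probability is at most `1`. -/
structure EpisodicMDP.Admissible {S A : Type} {H : ℕ} (M : EpisodicMDP S A H) (s₁ : S) :
    Prop where
  meanReward_nonneg : ∀ h s a, 0 ≤ M.meanReward h s a
  total_le_one : ∀ (s : Fin H → S) (a : Fin H → A),
    (∀ h : Fin H, h.val = 0 → s h = s₁) →
    (∀ h h' : Fin H, h'.val = h.val + 1 → M.trans h (s h) (a h) (s h') ≠ 0) →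
    ∑ h, M.meanReward h (s h) (a h) ≤ 1
  subgaussian : ∀ h s a,
    HasSubgaussianMGF (fun x => x - M.meanReward h s a) 1 (M.reward h s a : Measure ℝ)

/-- `M.valueToGo π n _ s` is the value of `π` from state `s` when `n` steps remain, i.e. the
value function at the step of index `H - n` (counted from `1`: at step `H - n + 1`), given by
backward recursion through the Q-function. -/
def EpisodicMDP.valueToGo (M : EpisodicMDP S A H) (π : Policy S A H) :
    (n : ℕ) → n ≤ H → S → ℝ
  | 0, _, _ => 0
  | n + 1, hn, s =>
    let h : Fin H := ⟨H - (n + 1), by omega⟩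
    ∑ a, π h s a *
      (M.meanReward h s a +
        ∑ s', (M.trans h s a s').toReal * M.valueToGo π n (Nat.le_of_succ_le hn) s')

/-- The value `V_M^π` of a policy started in `s₁`. -/
def EpisodicMDP.value (M : EpisodicMDP S A H) (s₁ : S) (π : Policy S A H) : ℝ :=
  M.valueToGo π H le_rfl s₁

/-- The optimal value `max_π V_M^π`. -/
def EpisodicMDP.optValue (M : EpisodicMDP S A H) (s₁ : S) : ℝ :=
  ⨆ π : Policy S A H, M.value s₁ π

/-! ### Interaction -/

/-- Finite sequences of length `n` of elements of `X`. -/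
def History (X : Type) : ℕ → Type
  | 0 => Unit
  | n + 1 => History X n × X

instance History.instMeasurableSpace (X : Type) [MeasurableSpace X] :
    (n : ℕ) → MeasurableSpace (History X n)
  | 0 => inferInstanceAs (MeasurableSpace Unit)
  | n + 1 =>
    letI := History.instMeasurableSpace X n
    inferInstanceAs (MeasurableSpace (History X n × X))

/-- What is observed in one episode: the sequence of `(s_h, a_h, reward at step h)`. -/
abbrev Trajectory (S A : Type) (H : ℕ) : Type := History (S × A × ℝ) H

/-- Drawing an action from `π_h(· | s)`. -/
def actionKernel (h : Fin H) : Kernel (Policy S A H × S) A where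
  toFun p := ∑ a, ENNReal.ofReal (p.1 h p.2 a) • Measure.dirac a
  measurable' := by
    refine Measure.measurable_of_measurable_coe _ fun B _ => ?_
    simp only [Measure.coe_finsetSum, Measure.coe_smul, Finset.sum_apply, Pi.smul_apply,
      smul_eq_mul]
    refine Finset.measurable_sum _ fun a _ => Measurable.mul_const ?_ _
    refine ENNReal.measurable_ofReal.comp ?_
    refine measurable_from_prod_countable_left fun s => ?_
    exact (measurable_pi_apply a).comp
      (measurable_subtype_coe.comp ((measurable_pi_apply s).comp (measurable_pi_apply h)))

/-- Given the current state and action at step `h`, the reward and the next state are drawn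
independently from `R_h(s, a)` and `P_h(· | s, a)`. -/
def EpisodicMDP.outcomeKernel (M : EpisodicMDP S A H) (h : Fin H) : Kernel (S × A) (ℝ × S) where
  toFun p := (M.reward h p.1 p.2 : Measure ℝ).prod (M.trans h p.1 p.2).toMeasure
  measurable' := measurable_of_countable _

/-- Law of the record of the first `n` steps of an episode together with the next state, as a
function of the policy that is executed. -/
def EpisodicMDP.stepsKernel (M : EpisodicMDP S A H) (s₁ : S) :
    (n : ℕ) → n ≤ H → Kernel (Policy S A H) (History (S × A × ℝ) n × S)
  | 0, _ => Kernel.const _ (Measure.dirac ((() : Unit), s₁))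
  | n + 1, hn =>
    ((M.stepsKernel s₁ n (Nat.le_of_succ_le hn) ⊗ₖ
        (actionKernel (S := S) (A := A) ⟨n, hn⟩).comap
          (fun p : Policy S A H × (History (S × A × ℝ) n × S) => (p.1, p.2.2)) (by fun_prop)) ⊗ₖ
        (M.outcomeKernel ⟨n, hn⟩).comap
          (fun p : Policy S A H × ((History (S × A × ℝ) n × S) × A) => (p.2.1.2, p.2.2))
          (by fun_prop)).map
      (fun q : ((History (S × A × ℝ) n × S) × A) × (ℝ × S) =>
        ((q.1.1.1, (q.1.1.2, q.1.2, q.2.1)), q.2.2))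

/-- Law of the trajectory of one episode, as a function of the policy that is executed. -/
def EpisodicMDP.episodeKernel (M : EpisodicMDP S A H) (s₁ : S) :
    Kernel (Policy S A H) (Trajectory S A H) :=
  (M.stepsKernel s₁ H le_rfl).map Prod.fst

/-- A pre-training and fine-tuning algorithm.

In the pre-training stage it draws i.i.d. instances, as many as it wants, and outputs some
information (policies, estimates, a random seed, …). It is allowed full access to the drawn
instances, which covers every way of interacting with them, directly or through oracles, for any
number of episodes.

In the test stage, the policy of episode `k` is chosen, possibly at random, from that information
and from the policies deployed and the trajectories observed in the episodes before. -/
structure Algorithm (S A : Type) [Fintype A] [MeasurableSpace S] [MeasurableSpace A]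
    (H : ℕ) where
  Info : Type
  [measurableSpaceInfo : MeasurableSpace Info]
  pretrain : Kernel (ℕ → EpisodicMDP S A H) Info
  [isMarkovKernel_pretrain : IsMarkovKernel pretrain]
  deploy : (k : ℕ) → Kernel (Info × History (Policy S A H × Trajectory S A H) k) (Policy S A H)
  [isMarkovKernel_deploy : ∀ k, IsMarkovKernel (deploy k)]

attribute [instance] Algorithm.measurableSpaceInfo Algorithm.isMarkovKernel_pretrain
  Algorithm.isMarkovKernel_deploy

/-- Law of the pre-training output when instances are drawn i.i.d. from `D`. -/
def Algorithm.infoLaw {S A : Type} [Fintype A] [MeasurableSpace S] [MeasurableSpace A] {H : ℕ}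
    (Alg : Algorithm S A H) (D : PMF (EpisodicMDP S A H)) : Measure Alg.Info :=
  (Measure.infinitePi (fun _ : ℕ => D.toMeasure)).bind Alg.pretrain

/-- Joint law of the pre-training output, distributed as `μ`, and of the first `k` test episodes
when the test instance is `M`. -/
def Algorithm.testLaw (Alg : Algorithm S A H) (s₁ : S) (μ : Measure Alg.Info)
    (M : EpisodicMDP S A H) :
    (k : ℕ) → Measure (Alg.Info × History (Policy S A H × Trajectory S A H) k)
  | 0 => μ.map (fun x => (x, (() : Unit)))
  | k + 1 =>
    ((Alg.testLaw s₁ μ M k ⊗ₘ Alg.deploy k) ⊗ₘ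
        (M.episodeKernel s₁).comap
          (fun p : (Alg.Info × History (Policy S A H × Trajectory S A H) k) × Policy S A H => p.2)
          measurable_snd).map
      (fun q => (q.1.1.1, (q.1.1.2, (q.1.2, q.2))))

/-- Expected test-stage regret over `K` episodes on the fixed instance `M`:
`E ∑_{k < K} (V_M^* - V_M^{π_k})`. -/
def Algorithm.instanceRegret (Alg : Algorithm S A H) (s₁ : S) (μ : Measure Alg.Info)
    (M : EpisodicMDP S A H) (K : ℕ) : ℝ :=
  ∑ k ∈ Finset.range K,
    ∫ π, (M.optValue s₁ - M.value s₁ π) ∂((Alg.testLaw s₁ μ M k).bind (Alg.deploy k))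

/-- The test-stage regret `Reg_K(D, Alg)`: the test instance is drawn from `D`, independently of
the i.i.d. instances from `D` used in pre-training. -/
def regret (s₁ : S) (D : PMF (EpisodicMDP S A H)) (Alg : Algorithm S A H) (K : ℕ) : ℝ :=
  ∑' M, (D M).toReal * Alg.instanceRegret s₁ (Alg.infoLaw D) M K

/-- The complexity `C(D)` at `K` test episodes: the least cardinality of a set of instances whose
probability under `D` is at least `1 - δ`, with `δ = 1 / √K`. -/
def complexity {S A : Type} {H : ℕ} (D : PMF (EpisodicMDP S A H)) (K : ℕ) : ℕ :=
  sInf {n | ∃ Ω' : Finset (EpisodicMDP S A H), Ω'.card = n ∧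
    1 - 1 / Real.sqrt K ≤ ∑ M ∈ Ω', (D M).toReal}

/-! ### Gaussian bandits -/

/-- The bandit with `m` arms (an MDP with one state and horizon `1`) in which the reward of arm `j`
is Gaussian with unit variance and mean `1/2`, raised by `Δ` on the single arm `i`. -/
def gaussianBandit {m : ℕ} (Δ : ℝ) (i : Fin m) : EpisodicMDP Unit (Fin m) 1 where
  trans _ _ _ := PMF.pure ()
  reward _ _ j := ⟨gaussianReal (1 / 2 + if j = i then Δ else 0) 1, inferInstance⟩

end RLGen

end

/-! The argument compares each instance with a reference bandit whose arms all have mean `1/2`. The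
test instance does not influence the pre-training output. Once the prior is fixed to be uniform,
that output is a random seed with some law `μ`, and the bounds below hold for every `μ`.

On `baseBandit` the expected probabilities of pulling the `m` arms in an episode sum to one, so most
arms are pulled rarely. Raising arm `i` by `Δ` changes the law of the history only through pulls of
`i`: the relative entropy of the reference history law with respect to the new one is `Δ ^ 2 / 2`
times the expected number of past pulls of `i` (`integrable_historyLogLik_and_integral_eq`). A
Pinsker-type inequality that is linear in the relative entropy (`integral_withDensity_exp_le`) turns
this into a bound on the probability of pulling `i` under `gaussianBandit Δ i`. Linearity allows
summation over `i` with no Cauchy–Schwarz step: the sum of these probabilities in episode `k` is at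
most `1 + m / 4 + 2 * Δ ^ 2 * k`.

If `16 * Δ ^ 2 * K ≤ m`, this is at most `7 * m / 8`, so every episode costs at least `Δ / 8` on
average over the instances. A gap `Δ` of order `min √(m * K) K / K` then gives the theorem, because
the complexity of the uniform distribution is at most `m`. -/

namespace RLGen

/-! ### One episode of a bandit: law, values and admissibility. -/

section Bandit

variable {m : ℕ}

/-- The trajectory of an episode of a bandit in which arm `a` is pulled and pays `r`. -/
def banditRecord (a : Fin m) (r : ℝ) : Trajectory Unit (Fin m) 1 := ((), ((), a, r))

lemma measurable_banditRecord (a : Fin m) : Measurable (banditRecord a) := by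
  change Measurable (fun r : ℝ => (((), ((), a, r)) : Unit × (Unit × Fin m × ℝ)))
  fun_prop

lemma policy_nonneg (π : Policy Unit (Fin m) 1) (i : Fin m) : 0 ≤ π 0 () i := (π 0 ()).2.1 i

lemma sum_ofReal_policy (π : Policy Unit (Fin m) 1) :
    ∑ a, ENNReal.ofReal (π 0 () a) = 1 := by
  have h : ∑ a, π 0 () a = 1 := (π 0 ()).2.2
  rw [← ENNReal.ofReal_sum_of_nonneg fun a _ => policy_nonneg π a, h, ENNReal.ofReal_one]

instance isMarkovKernel_actionKernel :
    IsMarkovKernel (actionKernel (S := Unit) (A := Fin m) (H := 1) 0) := by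
  refine ⟨fun p => ⟨?_⟩⟩
  simp [actionKernel, sum_ofReal_policy]

instance isMarkovKernel_outcomeKernel (M : EpisodicMDP Unit (Fin m) 1) :
    IsMarkovKernel (M.outcomeKernel 0) := by
  refine ⟨fun p => ?_⟩
  change IsProbabilityMeasure ((M.reward 0 p.1 p.2 : Measure ℝ).prod
    (M.trans 0 p.1 p.2).toMeasure)
  infer_instance

/-- With one state and one step, the iterated kernel product collapses to a mixture over arms. Later
computations about an episode rest on this form. -/
lemma lintegral_episodeKernel (M : EpisodicMDP Unit (Fin m) 1) (π : Policy Unit (Fin m) 1)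
    {f : Trajectory Unit (Fin m) 1 → ℝ≥0∞} (hf : Measurable f) :
    ∫⁻ t, f t ∂(M.episodeKernel () π) =
      ∑ a, ENNReal.ofReal (π 0 () a) *
        ∫⁻ r, f (banditRecord a r) ∂(M.reward 0 () a : Measure ℝ) := by
  have hact (a : Fin m) : Measurable fun r => f (banditRecord a r) :=
    hf.comp (measurable_banditRecord a)
  rw [EpisodicMDP.episodeKernel, Kernel.map_apply _ measurable_fst,
    lintegral_map hf measurable_fst, EpisodicMDP.stepsKernel, Kernel.map_apply _ (by fun_prop),
    lintegral_map (by fun_prop) (by fun_prop)]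
  change ∫⁻ q : ((Unit × Unit) × Fin m) × (ℝ × Unit), f (q.1.1.1, (q.1.1.2, q.1.2, q.2.1))
    ∂((((Kernel.const (Policy Unit (Fin m) 1) (Measure.dirac ((() : Unit), ()))) ⊗ₖ
        (actionKernel (S := Unit) (A := Fin m) (H := 1) 0).comap
          (fun p : Policy Unit (Fin m) 1 × (Unit × Unit) => (p.1, p.2.2)) (by fun_prop)) ⊗ₖ
        (M.outcomeKernel 0).comap
          (fun p : Policy Unit (Fin m) 1 × ((Unit × Unit) × Fin m) => (p.2.1.2, p.2.2))
          (by fun_prop)) π) = _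
  have hf' : Measurable fun q : ((Unit × Unit) × Fin m) × (ℝ × Unit) =>
      f (q.1.1.1, (q.1.1.2, q.1.2, q.2.1)) := by
    refine hf.comp ?_
    change Measurable fun q : ((Unit × Unit) × Fin m) × (ℝ × Unit) =>
      ((q.1.1.1, (q.1.1.2, q.1.2, q.2.1)) : Unit × (Unit × Fin m × ℝ))
    fun_prop
  rw [Kernel.lintegral_compProd _ _ _ hf',
    Kernel.lintegral_compProd _ _ _ (measurable_of_countable _)]
  simp only [Kernel.const_apply, lintegral_dirac, Kernel.comap_apply]
  change ∫⁻ a, _ ∂(∑ a, ENNReal.ofReal (π 0 () a) • Measure.dirac a) = _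
  simp only [lintegral_finsetSum_measure, lintegral_smul_measure, lintegral_dirac, smul_eq_mul]
  refine Finset.sum_congr rfl fun a _ => ?_
  congr 1
  change ∫⁻ c : ℝ × Unit, f (banditRecord a c.1)
    ∂((M.reward 0 () a : Measure ℝ).prod (M.trans 0 () a).toMeasure) = _
  have hfst : Measurable fun c : ℝ × Unit => f (banditRecord a c.1) := (hact a).comp measurable_fst
  rw [lintegral_prod _ hfst.aemeasurable]
  simp

lemma episodeKernel_apply (M : EpisodicMDP Unit (Fin m) 1) (π : Policy Unit (Fin m) 1) :
    M.episodeKernel () π = ∑ a, ENNReal.ofReal (π 0 () a) •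
      (M.reward 0 () a : Measure ℝ).map (banditRecord a) := by
  ext B hB
  have h := lintegral_episodeKernel M π (f := B.indicator 1) (by measurability)
  rw [lintegral_indicator_one hB] at h
  rw [h, Measure.coe_finsetSum, Finset.sum_apply]
  refine Finset.sum_congr rfl fun a _ => ?_
  rw [Measure.smul_apply, Measure.map_apply (measurable_banditRecord a) hB, smul_eq_mul,
    ← lintegral_indicator_one (measurable_banditRecord a hB)]
  rfl

instance isMarkovKernel_episodeKernel (M : EpisodicMDP Unit (Fin m) 1) :
    IsMarkovKernel (M.episodeKernel ()) := by
  refine ⟨fun π => ⟨?_⟩⟩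
  rw [← lintegral_one, lintegral_episodeKernel M π measurable_const]
  simp [sum_ofReal_policy]

lemma value_bandit (M : EpisodicMDP Unit (Fin m) 1) (π : Policy Unit (Fin m) 1) :
    M.value () π = ∑ a, π 0 () a * M.meanReward 0 () a := by
  simp [EpisodicMDP.value, EpisodicMDP.valueToGo]

lemma meanReward_gaussianBandit (Δ : ℝ) (i : Fin m) (h : Fin 1) (s : Unit) (j : Fin m) :
    (gaussianBandit Δ i).meanReward h s j = 1 / 2 + if j = i then Δ else 0 := by
  simp only [EpisodicMDP.meanReward, gaussianBandit, ProbabilityMeasure.coe_mk]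
  exact integral_id_gaussianReal

lemma value_gaussianBandit (Δ : ℝ) (i : Fin m) (π : Policy Unit (Fin m) 1) :
    (gaussianBandit Δ i).value () π = 1 / 2 + Δ * π 0 () i := by
  have h := (π 0 ()).2.2
  simp only [value_bandit, meanReward_gaussianBandit, mul_add, Finset.sum_add_distrib,
    ← Finset.sum_mul, mul_ite, mul_zero]
  simp only [Finset.sum_ite_eq', Finset.mem_univ, if_true]
  rw [show ∑ a, π 0 () a = 1 from h]
  ring

lemma policy_le_one (π : Policy Unit (Fin m) 1) (i : Fin m) : π 0 () i ≤ 1 := by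
  rw [← (π 0 ()).2.2]
  exact Finset.single_le_sum (f := fun a => π 0 () a) (fun a _ => policy_nonneg π a)
    (Finset.mem_univ i)

lemma measurable_policy_apply (i : Fin m) :
    Measurable (fun π : Policy Unit (Fin m) 1 => π 0 () i) :=
  (measurable_pi_apply i).comp
    (measurable_subtype_coe.comp ((measurable_pi_apply ()).comp (measurable_pi_apply 0)))

lemma optValue_gaussianBandit {Δ : ℝ} (hΔ : 0 ≤ Δ) (i : Fin m) :
    (gaussianBandit Δ i).optValue () = 1 / 2 + Δ := by
  have : Nonempty (Policy Unit (Fin m) 1) := ⟨fun _ _ => ⟨_, single_mem_stdSimplex ℝ i⟩⟩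
  have hle (π : Policy Unit (Fin m) 1) : (gaussianBandit Δ i).value () π ≤ 1 / 2 + Δ := by
    rw [value_gaussianBandit]
    nlinarith [policy_le_one π i]
  refine le_antisymm (ciSup_le hle) ?_
  refine le_trans (le_of_eq ?_) (le_ciSup (f := fun π => (gaussianBandit Δ i).value () π)
    ⟨_, Set.forall_mem_range.2 hle⟩ fun _ _ => ⟨_, single_mem_stdSimplex ℝ i⟩)
  simp only [value_gaussianBandit]
  change _ = 1 / 2 + Δ * (Pi.single i 1 : Fin m → ℝ) i
  simp

lemma admissible_gaussianBandit {Δ : ℝ} (hΔ : 0 ≤ Δ) (hΔ' : Δ ≤ 1 / 2) (i : Fin m) :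
    (gaussianBandit Δ i).Admissible () where
  meanReward_nonneg h s a := by
    rw [meanReward_gaussianBandit]
    split_ifs <;> linarith
  total_le_one s a _ _ := by
    simp only [meanReward_gaussianBandit, Finset.univ_unique, Finset.sum_singleton]
    split_ifs <;> linarith
  subgaussian h s a := by
    rw [meanReward_gaussianBandit]
    simp only [gaussianBandit, ProbabilityMeasure.coe_mk]
    generalize 1 / 2 + (if a = i then Δ else 0) = μ
    have hmap : (gaussianReal μ 1).map (fun x => x - μ) = gaussianReal 0 1 := by
      simp [gaussianReal_map_sub_const]
    refine ⟨fun t => ?_, fun t => by simp [mgf_gaussianReal hmap]⟩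
    rw [← mgf_pos_iff, mgf_gaussianReal hmap]
    exact Real.exp_pos _

lemma gaussianBandit_injective {Δ : ℝ} (hΔ : Δ ≠ 0) :
    Function.Injective (gaussianBandit (m := m) Δ) := by
  intro i j hij
  by_contra hne
  have h := meanReward_gaussianBandit Δ i 0 () i
  rw [hij, meanReward_gaussianBandit] at h
  exact hΔ (by simpa [hne] using h.symm)

/-- The weight is the ratio of the two Gaussian densities. This is the only likelihood ratio
computed by hand. -/
lemma lintegral_gaussianReal_add (μ Δ : ℝ) (f : ℝ → ℝ≥0∞) (hf : Measurable f) :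
    ∫⁻ x, f x ∂(gaussianReal (μ + Δ) 1) =
      ∫⁻ x, ENNReal.ofReal (Real.exp (Δ * (x - μ) - Δ ^ 2 / 2)) * f x ∂(gaussianReal μ 1) := by
  rw [gaussianReal_of_var_ne_zero _ one_ne_zero, gaussianReal_of_var_ne_zero _ one_ne_zero,
    lintegral_withDensity_eq_lintegral_mul _ (by fun_prop) hf,
    lintegral_withDensity_eq_lintegral_mul _ (by fun_prop) (by fun_prop)]
  refine lintegral_congr fun x => ?_
  simp only [Pi.mul_apply, gaussianPDF, ← mul_assoc]
  rw [← ENNReal.ofReal_mul (gaussianPDFReal_nonneg _ _ _)]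
  congr 2
  simp only [gaussianPDFReal, mul_assoc, ← Real.exp_add]
  congr 2
  simp
  ring

end Bandit

/-! ### A Pinsker inequality linear in the relative entropy. -/

/-- For `x ≤ 0` the left side is nonpositive and the right side is positive. For `x ≥ 0` the worst
case is `g = 1`, where the claim reads `4 / 3 * (x + 11 / 16) ≤ exp x`. -/
lemma exp_sub_one_mul_le {g : ℝ} (hg0 : 0 ≤ g) (hg1 : g ≤ 1) (x : ℝ) :
    (Real.exp x - 1) * g ≤ 1 / 4 + 4 * (Real.exp x - 1 - x) := by
  have hx : x + 1 ≤ Real.exp x := Real.add_one_le_exp x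
  -- A line of slope `4 / 3` is tangent to `exp` at `log (4 / 3)`; `5 / 16` is a rational point
  -- slightly above it that leaves exactly the intercept `11 / 16`.
  have hy := Real.add_one_le_exp (x - 5 / 16)
  have h43 : (4 / 3 : ℝ) ≤ Real.exp (5 / 16) := by
    have := Real.quadratic_le_exp_of_nonneg (x := 5 / 16) (by norm_num)
    linarith
  have hexp : Real.exp (x - 5 / 16) * (4 / 3) ≤ Real.exp x := by
    calc Real.exp (x - 5 / 16) * (4 / 3) ≤ Real.exp (x - 5 / 16) * Real.exp (5 / 16) := by gcongr
      _ = Real.exp x := by rw [← Real.exp_add]; congr 1; ring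
  rcases le_total (Real.exp x) 1 with h | h
  · nlinarith
  · nlinarith

/-- A linearised Pinsker inequality, where `-∫ X ∂P` is the relative entropy of `P` with respect to
the measure with density `exp X`. -/
lemma integral_withDensity_exp_le {Ω : Type*} [MeasurableSpace Ω] {P : Measure Ω}
    [IsProbabilityMeasure P] {X g : Ω → ℝ} (hXm : Measurable X) (hX : Integrable X P)
    [IsProbabilityMeasure (P.withDensity fun ω => ENNReal.ofReal (Real.exp (X ω)))]
    (hgm : Measurable g) (hg0 : ∀ ω, 0 ≤ g ω) (hg1 : ∀ ω, g ω ≤ 1) :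
    ∫ ω, g ω ∂(P.withDensity fun ω => ENNReal.ofReal (Real.exp (X ω))) ≤
      ∫ ω, g ω ∂P + 1 / 4 + 4 * -∫ ω, X ω ∂P := by
  -- The normalisation comes from the tilted measure being a probability measure. With it, the
  -- integral of `exp X - 1 - X` reduces to `-∫ X ∂P`.
  have hone : ∫⁻ ω, ENNReal.ofReal (Real.exp (X ω)) ∂P = 1 := by
    rw [← setLIntegral_univ, ← withDensity_apply _ MeasurableSet.univ, measure_univ]
  have hexp : Integrable (fun ω => Real.exp (X ω)) P := by
    refine ⟨by fun_prop, ?_⟩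
    rw [hasFiniteIntegral_iff_ofReal (ae_of_all _ fun ω => (Real.exp_pos _).le), hone]
    exact ENNReal.one_lt_top
  have hexp1 : ∫ ω, Real.exp (X ω) ∂P = 1 := by
    rw [integral_eq_lintegral_of_nonneg_ae (ae_of_all _ fun ω => (Real.exp_pos _).le)
      (by fun_prop), hone, ENNReal.toReal_one]
  have hg : Integrable g P := Integrable.of_bound (by fun_prop) 1
    (ae_of_all _ fun ω => by rw [Real.norm_of_nonneg (hg0 ω)]; exact hg1 ω)
  have hgexp : Integrable (fun ω => Real.exp (X ω) * g ω) P :=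
    hexp.mul_bdd (c := 1) (by fun_prop)
      (ae_of_all _ fun ω => by rw [Real.norm_of_nonneg (hg0 ω)]; exact hg1 ω)
  have hQ : ∫ ω, g ω ∂(P.withDensity fun ω => ENNReal.ofReal (Real.exp (X ω))) =
      ∫ ω, Real.exp (X ω) * g ω ∂P := by
    rw [integral_withDensity_eq_integral_toReal_smul (by fun_prop)
      (ae_of_all _ fun ω => ENNReal.ofReal_lt_top)]
    simp [ENNReal.toReal_ofReal, (Real.exp_pos _).le]
  have h1 : Integrable (fun ω => Real.exp (X ω) - 1) P := hexp.sub (integrable_const _)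
  have h2 : Integrable (fun ω => 4 * (Real.exp (X ω) - 1 - X ω)) P := (h1.sub hX).const_mul 4
  have h := integral_mono (μ := P) (f := fun ω => Real.exp (X ω) * g ω - g ω)
    (g := fun ω => 1 / 4 + 4 * (Real.exp (X ω) - 1 - X ω)) (hgexp.sub hg)
    ((integrable_const _).add h2)
    (fun ω => by linarith [exp_sub_one_mul_le (hg0 ω) (hg1 ω) (X ω)])
  rw [integral_sub hgexp hg, integral_add (integrable_const _) h2, integral_const_mul,
    integral_sub h1 hX, integral_sub hexp (integrable_const _), hexp1] at h
  simp at h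
  rw [hQ]
  linarith

/-! ### Log-likelihood ratios against the reference bandit. -/

section Bandit

variable {m : ℕ}

/-- The bandit in which every arm has mean reward `1/2`. -/
noncomputable def baseBandit (m : ℕ) : EpisodicMDP Unit (Fin m) 1 where
  trans _ _ _ := PMF.pure ()
  reward _ _ _ := ⟨gaussianReal (1 / 2) 1, inferInstance⟩

/-- Log-likelihood ratio of an episode, for `gaussianBandit Δ i` against `baseBandit`. -/
noncomputable def episodeLogLik (Δ : ℝ) (i : Fin m) (t : Trajectory Unit (Fin m) 1) : ℝ :=
  if t.2.2.1 = i then Δ * (t.2.2.2 - 1 / 2) - Δ ^ 2 / 2 else 0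

/-- Log-likelihood ratio of a test history, for `gaussianBandit Δ i` against `baseBandit`. -/
noncomputable def historyLogLik (Δ : ℝ) (i : Fin m) :
    (k : ℕ) → History (Policy Unit (Fin m) 1 × Trajectory Unit (Fin m) 1) k → ℝ
  | 0, _ => 0
  | k + 1, h => historyLogLik Δ i k h.1 + episodeLogLik Δ i h.2.2

lemma measurable_episodeLogLik (Δ : ℝ) (i : Fin m) : Measurable (episodeLogLik Δ i) := by
  change Measurable fun t : Unit × (Unit × Fin m × ℝ) =>
    if t.2.2.1 = i then Δ * (t.2.2.2 - 1 / 2) - Δ ^ 2 / 2 else 0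
  refine Measurable.ite ?_ (by fun_prop) (by fun_prop)
  exact (by fun_prop : Measurable fun t : Unit × (Unit × Fin m × ℝ) => t.2.2.1)
    (measurableSet_singleton i)

lemma measurable_historyLogLik (Δ : ℝ) (i : Fin m) (k : ℕ) :
    Measurable (historyLogLik Δ i k) := by
  induction k with
  | zero => exact measurable_const
  | succ k ih =>
    exact (ih.comp measurable_fst).add
      ((measurable_episodeLogLik Δ i).comp (measurable_snd.comp measurable_snd))

lemma lintegral_episodeKernel_gaussianBandit (Δ : ℝ) (i : Fin m) (π : Policy Unit (Fin m) 1)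
    {f : Trajectory Unit (Fin m) 1 → ℝ≥0∞} (hf : Measurable f) :
    ∫⁻ t, f t ∂((gaussianBandit Δ i).episodeKernel () π) =
      ∫⁻ t, ENNReal.ofReal (Real.exp (episodeLogLik Δ i t)) * f t
        ∂((baseBandit m).episodeKernel () π) := by
  have hl := measurable_episodeLogLik Δ i
  rw [lintegral_episodeKernel _ _ hf, lintegral_episodeKernel _ _ (by fun_prop)]
  refine Finset.sum_congr rfl fun a _ => ?_
  congr 1
  have hfa : Measurable fun r => f (banditRecord a r) := hf.comp (measurable_banditRecord a)
  by_cases hai : a = i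
  · simpa [gaussianBandit, baseBandit, episodeLogLik, banditRecord, hai] using
      lintegral_gaussianReal_add (1 / 2) Δ _ hfa
  · simp [gaussianBandit, baseBandit, episodeLogLik, banditRecord, hai]

lemma integrable_episodeLogLik_record (Δ : ℝ) (i a : Fin m) :
    Integrable (fun r => episodeLogLik Δ i (banditRecord a r)) (gaussianReal (1 / 2) 1) := by
  have hid : Integrable (fun x : ℝ => x) (gaussianReal (1 / 2) 1) :=
    (memLp_id_gaussianReal 1).integrable (by simp)
  by_cases hai : a = i
  · simp only [episodeLogLik, banditRecord, hai, if_true]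
    exact ((hid.sub (integrable_const _)).const_mul _).sub (integrable_const _)
  · simp [episodeLogLik, banditRecord, hai]

lemma integral_episodeLogLik_record (Δ : ℝ) (i a : Fin m) :
    ∫ r, episodeLogLik Δ i (banditRecord a r) ∂(gaussianReal (1 / 2) 1) =
      if a = i then -(Δ ^ 2 / 2) else 0 := by
  have hid : Integrable (fun x : ℝ => x) (gaussianReal (1 / 2) 1) :=
    (memLp_id_gaussianReal 1).integrable (by simp)
  by_cases hai : a = i
  · simp only [episodeLogLik, banditRecord, hai, if_true]
    have h : Integrable (fun x : ℝ => Δ * (x - 1 / 2)) (gaussianReal (1 / 2) 1) :=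
      (hid.sub (integrable_const _)).const_mul _
    rw [integral_sub h (integrable_const _), integral_const_mul,
      integral_sub hid (integrable_const _), integral_id_gaussianReal]
    simp
  · simp [episodeLogLik, banditRecord, hai]

lemma integrable_episodeLogLik (Δ : ℝ) (i : Fin m) (π : Policy Unit (Fin m) 1) :
    Integrable (episodeLogLik Δ i) ((baseBandit m).episodeKernel () π) := by
  rw [episodeKernel_apply, integrable_finsetSum_measure]
  intro a _
  refine Integrable.smul_measure ?_ ENNReal.ofReal_ne_top
  rw [integrable_map_measure (measurable_episodeLogLik Δ i).aestronglyMeasurable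
    (measurable_banditRecord a).aemeasurable]
  exact integrable_episodeLogLik_record Δ i a

/-- Bounding the policy weights by one makes the bound uniform in `π`, so that integrability
survives averaging over randomly chosen policies. -/
lemma exists_lintegral_episodeLogLik_le (Δ : ℝ) (i : Fin m) :
    ∃ C < ∞, ∀ π, ∫⁻ t, ‖episodeLogLik Δ i t‖ₑ ∂((baseBandit m).episodeKernel () π) ≤ C := by
  refine ⟨∑ a, ∫⁻ r, ‖episodeLogLik Δ i (banditRecord a r)‖ₑ ∂(gaussianReal (1 / 2) 1),
    ENNReal.sum_lt_top.2 fun a _ => (integrable_episodeLogLik_record Δ i a).hasFiniteIntegral,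
    fun π => ?_⟩
  rw [lintegral_episodeKernel _ _ (measurable_episodeLogLik Δ i).enorm]
  refine Finset.sum_le_sum fun a _ => mul_le_of_le_one_left' ?_
  exact ENNReal.ofReal_le_one.2 (policy_le_one π a)

/-- Up to sign, the information gained in one episode: a pull of `i` contributes `Δ ^ 2 / 2` and any
other pull nothing. -/
lemma integral_episodeLogLik (Δ : ℝ) (i : Fin m) (π : Policy Unit (Fin m) 1) :
    ∫ t, episodeLogLik Δ i t ∂((baseBandit m).episodeKernel () π) = -(Δ ^ 2 / 2) * π 0 () i := by
  have h := integrable_episodeLogLik Δ i π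
  rw [episodeKernel_apply, integrable_finsetSum_measure] at h
  rw [episodeKernel_apply, integral_finsetSum_measure h]
  have (a : Fin m) : ∫ t, episodeLogLik Δ i t ∂(ENNReal.ofReal (π 0 () a) •
      ((baseBandit m).reward 0 () a : Measure ℝ).map (banditRecord a)) =
      if a = i then -(Δ ^ 2 / 2) * π 0 () i else 0 := by
    rw [integral_smul_measure, integral_map (measurable_banditRecord a).aemeasurable
      (measurable_episodeLogLik Δ i).aestronglyMeasurable, ENNReal.toReal_ofReal
      (policy_nonneg π a)]
    simp only [baseBandit, ProbabilityMeasure.coe_mk, integral_episodeLogLik_record]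
    split_ifs with hai
    · rw [hai, smul_eq_mul, mul_comm]
    · simp
  simp [this]

/-! ### Change of measure along the test stage. -/

namespace Algorithm

variable (Alg : Algorithm Unit (Fin m) 1)

/-- The law of the next policy and of the trajectory it generates on `M`. -/
noncomputable def roundKernel (M : EpisodicMDP Unit (Fin m) 1) (k : ℕ) :
    Kernel (Alg.Info × History (Policy Unit (Fin m) 1 × Trajectory Unit (Fin m) 1) k)
      (Policy Unit (Fin m) 1 × Trajectory Unit (Fin m) 1) :=
  Alg.deploy k ⊗ₖ (M.episodeKernel ()).comap
    (fun p : (Alg.Info × History (Policy Unit (Fin m) 1 × Trajectory Unit (Fin m) 1) k) ×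
      Policy Unit (Fin m) 1 => p.2) measurable_snd

instance isMarkovKernel_roundKernel (M : EpisodicMDP Unit (Fin m) 1) (k : ℕ) :
    IsMarkovKernel (Alg.roundKernel M k) := by
  unfold roundKernel
  infer_instance

/-- Appending a round to a history. -/
def appendRound {I X : Type} {k : ℕ} (q : (I × History X k) × X) : I × History X (k + 1) :=
  (q.1.1, (q.1.2, q.2))

lemma historyLogLik_appendRound {I : Type} (Δ : ℝ) (i : Fin m) (k : ℕ)
    (h : I × History (Policy Unit (Fin m) 1 × Trajectory Unit (Fin m) 1) k)
    (q : Policy Unit (Fin m) 1 × Trajectory Unit (Fin m) 1) :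
    historyLogLik Δ i (k + 1) (appendRound (h, q)).2 =
      historyLogLik Δ i k h.2 + episodeLogLik Δ i q.2 := by
  simp only [historyLogLik, appendRound]

lemma measurable_historyLogLik_snd {I : Type} [MeasurableSpace I] (Δ : ℝ) (i : Fin m) (k : ℕ) :
    Measurable fun x : I × History (Policy Unit (Fin m) 1 × Trajectory Unit (Fin m) 1) k =>
      historyLogLik Δ i k x.2 :=
  (measurable_historyLogLik Δ i k).comp measurable_snd

lemma measurable_appendRound {I X : Type} [MeasurableSpace I] [MeasurableSpace X] {k : ℕ} :
    Measurable (appendRound : (I × History X k) × X → I × History X (k + 1)) :=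
  (measurable_fst.comp measurable_fst).prodMk
    ((measurable_snd.comp measurable_fst).prodMk measurable_snd :
      Measurable fun q : (I × History X k) × X => ((q.1.2, q.2) : History X k × X))

instance isProbabilityMeasure_testLaw (μ : Measure Alg.Info) [IsProbabilityMeasure μ]
    (M : EpisodicMDP Unit (Fin m) 1) (k : ℕ) : IsProbabilityMeasure (Alg.testLaw () μ M k) := by
  induction k with
  | zero =>
    exact Measure.isProbabilityMeasure_map (measurable_id.prodMk measurable_const).aemeasurable
  | succ k ih =>
    refine Measure.isProbabilityMeasure_map (Measurable.aemeasurable ?_)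
    exact (measurable_fst.comp (measurable_fst.comp measurable_fst)).prodMk
      ((measurable_snd.comp (measurable_fst.comp measurable_fst)).prodMk
        ((measurable_snd.comp measurable_fst).prodMk measurable_snd))

/-- Associativity of the kernel product: policy and trajectory are grouped into one round, which
makes the induction over episodes one-step. -/
lemma testLaw_succ (μ : Measure Alg.Info) [IsProbabilityMeasure μ]
    (M : EpisodicMDP Unit (Fin m) 1) (k : ℕ) :
    Alg.testLaw () μ M (k + 1) =
      (Alg.testLaw () μ M k ⊗ₘ Alg.roundKernel M k).map appendRound := by
  refine Measure.ext_of_lintegral _ fun f hf => ?_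
  have hm : Measurable fun q : ((Alg.Info × History (Policy Unit (Fin m) 1 ×
      Trajectory Unit (Fin m) 1) k) × Policy Unit (Fin m) 1) × Trajectory Unit (Fin m) 1 =>
      appendRound (q.1.1, (q.1.2, q.2)) :=
    measurable_appendRound.comp (by fun_prop)
  have hfm : Measurable fun q : ((Alg.Info × History (Policy Unit (Fin m) 1 ×
      Trajectory Unit (Fin m) 1) k) × Policy Unit (Fin m) 1) × Trajectory Unit (Fin m) 1 =>
      f (appendRound (q.1.1, (q.1.2, q.2))) := hf.comp hm
  have hfa : Measurable fun q : (Alg.Info × History (Policy Unit (Fin m) 1 ×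
      Trajectory Unit (Fin m) 1) k) × (Policy Unit (Fin m) 1 × Trajectory Unit (Fin m) 1) =>
      f (appendRound q) := hf.comp measurable_appendRound
  rw [lintegral_map hf measurable_appendRound, Measure.lintegral_compProd hfa]
  refine (lintegral_map hf hm).trans ?_
  rw [Measure.lintegral_compProd hfm, Measure.lintegral_compProd
    hfm.lintegral_kernel_prod_right']
  refine lintegral_congr fun h => ?_
  rw [roundKernel]
  exact (Kernel.lintegral_compProd _ _ _ (hfa.comp measurable_prodMk_left)).symm

lemma lintegral_testLaw_succ (μ : Measure Alg.Info) [IsProbabilityMeasure μ]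
    (M : EpisodicMDP Unit (Fin m) 1) (k : ℕ)
    {f : Alg.Info × History (Policy Unit (Fin m) 1 × Trajectory Unit (Fin m) 1) (k + 1) → ℝ≥0∞}
    (hf : Measurable f) :
    ∫⁻ x, f x ∂(Alg.testLaw () μ M (k + 1)) =
      ∫⁻ h, ∫⁻ q, f (appendRound (h, q)) ∂(Alg.roundKernel M k h) ∂(Alg.testLaw () μ M k) := by
  rw [testLaw_succ, lintegral_map hf measurable_appendRound]
  exact Measure.lintegral_compProd (hf.comp measurable_appendRound)

lemma lintegral_roundKernel_gaussianBandit (Δ : ℝ) (i : Fin m) (k : ℕ)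
    (h : Alg.Info × History (Policy Unit (Fin m) 1 × Trajectory Unit (Fin m) 1) k)
    {f : Policy Unit (Fin m) 1 × Trajectory Unit (Fin m) 1 → ℝ≥0∞} (hf : Measurable f) :
    ∫⁻ q, f q ∂(Alg.roundKernel (gaussianBandit Δ i) k h) =
      ∫⁻ q, ENNReal.ofReal (Real.exp (episodeLogLik Δ i q.2)) * f q
        ∂(Alg.roundKernel (baseBandit m) k h) := by
  have hl := measurable_episodeLogLik Δ i
  rw [roundKernel, roundKernel, Kernel.lintegral_compProd _ _ _ hf,
    Kernel.lintegral_compProd _ _ _ (by fun_prop)]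
  refine lintegral_congr fun π => ?_
  simp only [Kernel.comap_apply]
  exact lintegral_episodeKernel_gaussianBandit Δ i π (hf.comp measurable_prodMk_left)

/-- The seed law and the deployment kernels are the same on both instances, so they cancel in the
likelihood ratio and only reward densities remain, multiplied over episodes. -/
lemma lintegral_testLaw_gaussianBandit (μ : Measure Alg.Info) [IsProbabilityMeasure μ]
    (Δ : ℝ) (i : Fin m) (k : ℕ)
    {f : Alg.Info × History (Policy Unit (Fin m) 1 × Trajectory Unit (Fin m) 1) k → ℝ≥0∞}
    (hf : Measurable f) :
    ∫⁻ x, f x ∂(Alg.testLaw () μ (gaussianBandit Δ i) k) =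
      ∫⁻ x, ENNReal.ofReal (Real.exp (historyLogLik Δ i k x.2)) * f x
        ∂(Alg.testLaw () μ (baseBandit m) k) := by
  induction k with
  | zero =>
    simp only [historyLogLik, Real.exp_zero, ENNReal.ofReal_one, one_mul, testLaw]
  | succ k ih =>
    have hL := measurable_historyLogLik Δ i (k + 1)
    have hfa : Measurable fun q : (Alg.Info × History (Policy Unit (Fin m) 1 ×
        Trajectory Unit (Fin m) 1) k) × (Policy Unit (Fin m) 1 × Trajectory Unit (Fin m) 1) =>
        f (appendRound q) := hf.comp measurable_appendRound
    have hround (h) : Measurable fun q => f (appendRound (h, q)) :=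
      hfa.comp measurable_prodMk_left
    have hmeas := hfa.lintegral_kernel_prod_right'
        (κ := Alg.roundKernel (gaussianBandit Δ i) k)
    rw [lintegral_testLaw_succ _ _ _ _ hf, ih hmeas, lintegral_testLaw_succ _ _ _ _ (by fun_prop)]
    refine lintegral_congr fun h => ?_
    rw [Alg.lintegral_roundKernel_gaussianBandit Δ i k h (hround h),
      ← lintegral_const_mul' _ _ ENNReal.ofReal_ne_top]
    refine lintegral_congr fun q => ?_
    rw [← mul_assoc, ← ENNReal.ofReal_mul (Real.exp_pos _).le, ← Real.exp_add,
      historyLogLik_appendRound]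

lemma testLaw_gaussianBandit (μ : Measure Alg.Info) [IsProbabilityMeasure μ]
    (Δ : ℝ) (i : Fin m) (k : ℕ) :
    Alg.testLaw () μ (gaussianBandit Δ i) k = (Alg.testLaw () μ (baseBandit m) k).withDensity
      fun x => ENNReal.ofReal (Real.exp (historyLogLik Δ i k x.2)) := by
  refine Measure.ext_of_lintegral _ fun f hf => ?_
  have hL := measurable_historyLogLik Δ i k
  rw [lintegral_testLaw_gaussianBandit _ _ _ _ _ hf,
    lintegral_withDensity_eq_lintegral_mul _ (by fun_prop) hf]
  rfl

/-- The conditional probability of pulling arm `i` in episode `k`. -/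
noncomputable def pullProb (i : Fin m) (k : ℕ)
    (h : Alg.Info × History (Policy Unit (Fin m) 1 × Trajectory Unit (Fin m) 1) k) : ℝ :=
  ∫ π, π 0 () i ∂(Alg.deploy k h)

lemma integrable_policy_apply (ν : Measure (Policy Unit (Fin m) 1)) [IsFiniteMeasure ν]
    (i : Fin m) : Integrable (fun π => π 0 () i) ν :=
  Integrable.of_bound (measurable_policy_apply i).aestronglyMeasurable 1
    (ae_of_all _ fun π => by rw [Real.norm_of_nonneg (policy_nonneg π i)]; exact policy_le_one π i)

lemma measurable_pullProb (i : Fin m) (k : ℕ) : Measurable (Alg.pullProb i k) :=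
  (measurable_policy_apply i).stronglyMeasurable.integral_kernel.measurable

lemma pullProb_nonneg (i : Fin m) (k : ℕ)
    (h : Alg.Info × History (Policy Unit (Fin m) 1 × Trajectory Unit (Fin m) 1) k) :
    0 ≤ Alg.pullProb i k h :=
  integral_nonneg fun π => policy_nonneg π i

lemma sum_pullProb (k : ℕ)
    (h : Alg.Info × History (Policy Unit (Fin m) 1 × Trajectory Unit (Fin m) 1) k) :
    ∑ i, Alg.pullProb i k h = 1 := by
  simp only [pullProb]
  rw [← integral_finsetSum _ fun i _ => integrable_policy_apply _ i]
  have (π : Policy Unit (Fin m) 1) : ∑ a, π 0 () a = 1 := (π 0 ()).2.2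
  simp [this]

lemma pullProb_le_one (i : Fin m) (k : ℕ)
    (h : Alg.Info × History (Policy Unit (Fin m) 1 × Trajectory Unit (Fin m) 1) k) :
    Alg.pullProb i k h ≤ 1 := by
  rw [← Alg.sum_pullProb k h]
  exact Finset.single_le_sum (f := fun a => Alg.pullProb a k h)
    (fun a _ => Alg.pullProb_nonneg a k h) (Finset.mem_univ i)

lemma integrable_pullProb (μ : Measure Alg.Info) [IsProbabilityMeasure μ]
    (M : EpisodicMDP Unit (Fin m) 1) (i : Fin m) (k : ℕ) :
    Integrable (Alg.pullProb i k) (Alg.testLaw () μ M k) :=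
  Integrable.of_bound (Alg.measurable_pullProb i k).aestronglyMeasurable 1 (ae_of_all _ fun h => by
    rw [Real.norm_of_nonneg (Alg.pullProb_nonneg i k h)]; exact Alg.pullProb_le_one i k h)

lemma integrable_roundLogLik (μ : Measure Alg.Info) [IsProbabilityMeasure μ] (Δ : ℝ) (i : Fin m)
    (k : ℕ) : Integrable (fun p => episodeLogLik Δ i p.2.2)
      (Alg.testLaw () μ (baseBandit m) k ⊗ₘ Alg.roundKernel (baseBandit m) k) := by
  have hl := measurable_episodeLogLik Δ i
  refine ⟨(by fun_prop : Measurable _).aestronglyMeasurable, ?_⟩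
  obtain ⟨C, hC, hle⟩ := exists_lintegral_episodeLogLik_le Δ i
  rw [hasFiniteIntegral_def, Measure.lintegral_compProd (by fun_prop)]
  refine lt_of_le_of_lt (lintegral_mono fun h => ?_) (b := ∫⁻ _, C ∂_) (by simpa using hC)
  rw [roundKernel, Kernel.lintegral_compProd _ _ _ (by fun_prop)]
  refine (lintegral_mono fun π => hle π).trans (by simp)

lemma integral_roundLogLik (μ : Measure Alg.Info) [IsProbabilityMeasure μ] (Δ : ℝ) (i : Fin m)
    (k : ℕ) : ∫ p, episodeLogLik Δ i p.2.2
      ∂(Alg.testLaw () μ (baseBandit m) k ⊗ₘ Alg.roundKernel (baseBandit m) k) =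
      -(Δ ^ 2 / 2) * ∫ h, Alg.pullProb i k h ∂(Alg.testLaw () μ (baseBandit m) k) := by
  have hint := Alg.integrable_roundLogLik μ Δ i k
  rw [Measure.integral_compProd hint, ← integral_const_mul]
  refine integral_congr_ae ?_
  filter_upwards [hint.ae_of_compProd] with h hh
  rw [roundKernel] at hh ⊢
  rw [integral_compProd hh, pullProb, ← integral_const_mul]
  refine integral_congr_ae (ae_of_all _ fun π => ?_)
  exact integral_episodeLogLik Δ i π

/-- The chain rule for relative entropy. The two claims share one induction because splitting the
integral of a sum needs integrability of the past. -/
lemma integrable_historyLogLik_and_integral_eq (μ : Measure Alg.Info) [IsProbabilityMeasure μ]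
    (Δ : ℝ) (i : Fin m) (k : ℕ) :
    Integrable (fun x => historyLogLik Δ i k x.2) (Alg.testLaw () μ (baseBandit m) k) ∧
    ∫ x, historyLogLik Δ i k x.2 ∂(Alg.testLaw () μ (baseBandit m) k) = -(Δ ^ 2 / 2) *
      ∑ t ∈ Finset.range k, ∫ h, Alg.pullProb i t h ∂(Alg.testLaw () μ (baseBandit m) t) := by
  induction k with
  | zero => simp [historyLogLik]
  | succ k ih =>
    obtain ⟨ihi, ihe⟩ := ih
    have hround := Alg.integrable_roundLogLik μ Δ i k
    have hfst : (Alg.testLaw () μ (baseBandit m) k ⊗ₘ Alg.roundKernel (baseBandit m) k).map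
        Prod.fst = Alg.testLaw () μ (baseBandit m) k := Measure.fst_compProd _ _
    have hpast : Integrable (fun p => historyLogLik Δ i k p.1.2)
        (Alg.testLaw () μ (baseBandit m) k ⊗ₘ Alg.roundKernel (baseBandit m) k) := by
      rw [← hfst] at ihi
      exact ihi.comp_measurable measurable_fst
    have hpast' : ∫ p, historyLogLik Δ i k p.1.2
        ∂(Alg.testLaw () μ (baseBandit m) k ⊗ₘ Alg.roundKernel (baseBandit m) k) =
        ∫ x, historyLogLik Δ i k x.2 ∂(Alg.testLaw () μ (baseBandit m) k) := by
      conv_rhs => rw [← hfst]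
      rw [integral_map measurable_fst.aemeasurable
        (measurable_historyLogLik_snd Δ i k).aestronglyMeasurable]
    rw [testLaw_succ]
    constructor
    · rw [integrable_map_measure
        (measurable_historyLogLik_snd Δ i (k + 1)).aestronglyMeasurable
        measurable_appendRound.aemeasurable]
      exact (hpast.add hround).congr
        (ae_of_all _ fun p => (historyLogLik_appendRound Δ i k p.1 p.2).symm)
    · rw [integral_map measurable_appendRound.aemeasurable
        (measurable_historyLogLik_snd Δ i (k + 1)).aestronglyMeasurable,
        Finset.sum_range_succ, mul_add, ← ihe, ← Alg.integral_roundLogLik μ Δ i k, ← hpast',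
        ← integral_add hpast hround]
      exact integral_congr_ae (ae_of_all _ fun p => historyLogLik_appendRound Δ i k p.1 p.2)

/-! ### Pull probabilities and regret. -/

lemma integral_pullProb_gaussianBandit_le (μ : Measure Alg.Info) [IsProbabilityMeasure μ] (Δ : ℝ)
    (i : Fin m) (k : ℕ) :
    ∫ h, Alg.pullProb i k h ∂(Alg.testLaw () μ (gaussianBandit Δ i) k) ≤
      ∫ h, Alg.pullProb i k h ∂(Alg.testLaw () μ (baseBandit m) k) + 1 / 4 + 2 * Δ ^ 2 *
        ∑ t ∈ Finset.range k, ∫ h, Alg.pullProb i t h ∂(Alg.testLaw () μ (baseBandit m) t) := by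
  obtain ⟨hint, heq⟩ := Alg.integrable_historyLogLik_and_integral_eq μ Δ i k
  have hprob := Alg.isProbabilityMeasure_testLaw μ (gaussianBandit Δ i) k
  rw [testLaw_gaussianBandit] at hprob ⊢
  refine (integral_withDensity_exp_le (measurable_historyLogLik_snd Δ i k) hint
    (Alg.measurable_pullProb i k) (Alg.pullProb_nonneg i k) (Alg.pullProb_le_one i k)).trans ?_
  rw [heq]
  linarith

/-- The value is affine in the weight of arm `i`, so an episode loses `Δ` times the probability of
missing that arm. -/
lemma instanceRegret_gaussianBandit (μ : Measure Alg.Info) [IsProbabilityMeasure μ] {Δ : ℝ}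
    (hΔ : 0 ≤ Δ) (i : Fin m) (K : ℕ) :
    Alg.instanceRegret () μ (gaussianBandit Δ i) K = ∑ k ∈ Finset.range K,
      Δ * (1 - ∫ h, Alg.pullProb i k h ∂(Alg.testLaw () μ (gaussianBandit Δ i) k)) := by
  refine Finset.sum_congr rfl fun k _ => ?_
  have hi := integrable_policy_apply
    (Alg.deploy k ∘ₘ Alg.testLaw () μ (gaussianBandit Δ i) k) i
  have hbind : ∫ π, π 0 () i ∂(Alg.deploy k ∘ₘ Alg.testLaw () μ (gaussianBandit Δ i) k) =
      ∫ h, Alg.pullProb i k h ∂(Alg.testLaw () μ (gaussianBandit Δ i) k) := by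
    rw [← Measure.snd_compProd] at hi ⊢
    rw [Measure.snd, integral_map measurable_snd.aemeasurable
      (measurable_policy_apply i).aestronglyMeasurable]
    exact Measure.integral_compProd (hi.comp_measurable measurable_snd)
  rw [← hbind]
  simp only [optValue_gaussianBandit hΔ, value_gaussianBandit]
  rw [show (fun π : Policy Unit (Fin m) 1 => 1 / 2 + Δ - (1 / 2 + Δ * π 0 () i)) =
    fun π => Δ * (1 - π 0 () i) by ext; ring, integral_const_mul,
    integral_sub (integrable_const _) hi]
  simp

/-- On the Gaussian bandits with gap `Δ`, no algorithm identifies the best arm on average. -/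
lemma sum_integral_pullProb_gaussianBandit_le (μ : Measure Alg.Info) [IsProbabilityMeasure μ]
    (Δ : ℝ) (k : ℕ) :
    ∑ i, ∫ h, Alg.pullProb i k h ∂(Alg.testLaw () μ (gaussianBandit Δ i) k) ≤
      1 + m / 4 + 2 * Δ ^ 2 * k := by
  have hone (t : ℕ) :
      ∑ i, ∫ h, Alg.pullProb i t h ∂(Alg.testLaw () μ (baseBandit m) t) = 1 := by
    rw [← integral_finsetSum _ fun i _ => Alg.integrable_pullProb μ (baseBandit m) i t]
    simp [sum_pullProb]
  refine (Finset.sum_le_sum fun i _ =>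
    Alg.integral_pullProb_gaussianBandit_le μ Δ i k).trans_eq ?_
  rw [Finset.sum_add_distrib, Finset.sum_add_distrib, ← Finset.mul_sum, Finset.sum_comm, hone]
  simp only [hone]
  simp
  ring

lemma sum_instanceRegret_gaussianBandit_ge (μ : Measure Alg.Info) [IsProbabilityMeasure μ]
    {Δ : ℝ} (hΔ : 0 ≤ Δ) {K : ℕ} (hm : 2 ≤ m) (hK : 16 * Δ ^ 2 * K ≤ m) :
    m * (Δ * K / 8) ≤ ∑ i, Alg.instanceRegret () μ (gaussianBandit Δ i) K := by
  have hm' : (2 : ℝ) ≤ m := by exact_mod_cast hm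
  simp only [Alg.instanceRegret_gaussianBandit μ hΔ]
  rw [Finset.sum_comm]
  have hround (k : ℕ) (hk : k ∈ Finset.range K) : m * (Δ / 8) ≤ ∑ i : Fin m,
      Δ * (1 - ∫ h, Alg.pullProb i k h ∂(Alg.testLaw () μ (gaussianBandit Δ i) k)) := by
    rw [← Finset.mul_sum, Finset.sum_sub_distrib]
    have h := Alg.sum_integral_pullProb_gaussianBandit_le μ Δ k
    have hkK : (k : ℝ) ≤ K := by exact_mod_cast (Finset.mem_range.1 hk).le
    have : 16 * Δ ^ 2 * k ≤ 16 * Δ ^ 2 * K := by gcongr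
    have hcard : ∑ _i : Fin m, (1 : ℝ) = m := by simp
    rw [hcard]
    calc (m : ℝ) * (Δ / 8) = Δ * (m / 8) := by ring
      -- The probabilities sum to at most `m / 2 + m / 4 + m / 8`, using `1 ≤ m / 2` and `2 * Δ ^ 2
      -- * k ≤ m / 8`; this leaves `m / 8`.
      _ ≤ _ := by gcongr; linarith
  calc (m : ℝ) * (Δ * K / 8) = ∑ _k ∈ Finset.range K, (m : ℝ) * (Δ / 8) := by
        simp; ring
    _ ≤ _ := Finset.sum_le_sum hround

end Algorithm

end Bandit

/-! ### Choice of the gap. -/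

lemma exists_gap {m K : ℕ} (hm : 2 ≤ m) (hK : 5 ≤ K) :
    ∃ Δ : ℝ, 0 < Δ ∧ Δ ≤ 1 / 2 ∧ 16 * Δ ^ 2 * K ≤ m ∧
      1 / 4 * min √(m * K) K ≤ Δ * K := by
  have hK0 : (0 : ℝ) < K := by exact_mod_cast (by omega : 0 < K)
  have hm0 : (0 : ℝ) < m := by exact_mod_cast (by omega : 0 < m)
  have hs : √(m * K) ^ 2 = m * K := Real.sq_sqrt (by positivity)
  obtain ⟨x, hx⟩ : ∃ x, x = min √((m : ℝ) * K) K := ⟨_, rfl⟩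
  have hpos : 0 < x := hx ▸ lt_min (by positivity) hK0
  have hxK : x ≤ K := hx ▸ min_le_right _ _
  have hle : x ^ 2 ≤ m * K := by
    rw [← hs]
    exact pow_le_pow_left₀ hpos.le (hx ▸ min_le_left _ _) 2
  rw [← hx]
  -- The bound `x ≤ K` keeps the gap below `1 / 2`, and `x ^ 2 ≤ m * K` is exactly the information
  -- constraint.
  refine ⟨x / (4 * K), by positivity, ?_, ?_, le_of_eq (by field_simp)⟩
  · rw [div_le_iff₀ (by positivity)]
    linarith
  · rw [show 16 * (x / (4 * K)) ^ 2 * K = x ^ 2 / K by field_simp; norm_num, div_le_iff₀ hK0]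
    exact hle

/-! ### The uniform distribution over instances. -/

section Uniform

variable {m : ℕ} [NeZero m]

/-- The uniform distribution on the Gaussian bandits with gap `Δ`. -/
noncomputable def uniformBandit (m : ℕ) [NeZero m] (Δ : ℝ) : PMF (EpisodicMDP Unit (Fin m) 1) :=
  (PMF.uniformOfFintype (Fin m)).map (gaussianBandit Δ)

lemma support_uniformBandit (Δ : ℝ) :
    (uniformBandit m Δ).support = Set.range (gaussianBandit Δ) := by
  simp [uniformBandit, PMF.support_map]

lemma uniformBandit_apply {Δ : ℝ} (hΔ : Δ ≠ 0) (i : Fin m) :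
    uniformBandit m Δ (gaussianBandit Δ i) = (m : ℝ≥0∞)⁻¹ := by
  rw [uniformBandit, PMF.map_apply, tsum_eq_single i]
  · simp
  · intro j hj
    rw [if_neg fun h => hj (gaussianBandit_injective hΔ h).symm]

/-- The full support has mass one, hence is a competitor. An upper bound suffices because the
claimed regret bound increases with the complexity. -/
lemma complexity_uniformBandit_le {Δ : ℝ} (hΔ : Δ ≠ 0) (K : ℕ) :
    complexity (uniformBandit m Δ) K ≤ m := by
  classical
  refine Nat.sInf_le ⟨Finset.univ.image (gaussianBandit Δ), ?_, ?_⟩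
  · rw [Finset.card_image_of_injective _ (gaussianBandit_injective hΔ), Finset.card_univ,
      Fintype.card_fin]
  · rw [Finset.sum_image (gaussianBandit_injective hΔ).injOn]
    simp only [uniformBandit_apply hΔ]
    have : (m : ℝ) ≠ 0 := NeZero.ne _
    simp [this]

lemma regret_uniformBandit {Δ : ℝ} (hΔ : Δ ≠ 0) (Alg : Algorithm Unit (Fin m) 1) (K : ℕ) :
    regret () (uniformBandit m Δ) Alg K = (m : ℝ)⁻¹ * ∑ i,
      Alg.instanceRegret () (Alg.infoLaw (uniformBandit m Δ)) (gaussianBandit Δ i) K := by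
  rw [regret, ← (gaussianBandit_injective hΔ).tsum_eq, tsum_fintype, Finset.mul_sum]
  · simp [uniformBandit_apply hΔ]
  · intro M hM
    rw [← support_uniformBandit, PMF.mem_support_iff]
    intro h
    simp [h] at hM

end Uniform

instance isProbabilityMeasure_infoLaw {S A : Type} [Fintype A] [MeasurableSpace S]
    [MeasurableSpace A] {H : ℕ} (Alg : Algorithm S A H) (D : PMF (EpisodicMDP S A H)) :
    IsProbabilityMeasure (Alg.infoLaw D) := by
  unfold Algorithm.infoLaw
  infer_instance

end RLGen

/-! ### The lower bound. -/

theorem theorem3 :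
    ∃ c : ℝ, 0 < c ∧ ∀ m K : ℕ, 2 ≤ m → 5 ≤ K →
      ∃ Δ : ℝ, 0 < Δ ∧ Δ ≤ 1 / 2 ∧
      ∃ Ω : Set (RLGen.EpisodicMDP Unit (Fin m) 1),
        Ω = Set.range (RLGen.gaussianBandit Δ) ∧ Ω.ncard = m ∧ (∀ M ∈ Ω, M.Admissible ()) ∧
        ∀ Alg : RLGen.Algorithm Unit (Fin m) 1,
          ∃ D : PMF (RLGen.EpisodicMDP Unit (Fin m) 1),
            D.support = Ω ∧ (∀ M ∈ Ω, D M = (m : ENNReal)⁻¹) ∧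
            c * min (Real.sqrt (RLGen.complexity D K * K)) K ≤ RLGen.regret () D Alg K := by
  -- A factor `1 / 4` comes from the gap and `1 / 8` from the average loss per episode relative to
  -- `Δ`.
  refine ⟨1 / 32, by norm_num, fun m K hm hK => ?_⟩
  have : NeZero m := ⟨by omega⟩
  have hm0 : (0 : ℝ) < m := by exact_mod_cast (by omega : 0 < m)
  obtain ⟨Δ, hΔ, hΔ', hgap, hmin⟩ := RLGen.exists_gap hm hK
  refine ⟨Δ, hΔ, hΔ', _, rfl, ?_, ?_, fun Alg => ⟨RLGen.uniformBandit m Δ,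
    RLGen.support_uniformBandit Δ, ?_, ?_⟩⟩
  · rw [← Set.image_univ, Set.ncard_image_of_injective _ (RLGen.gaussianBandit_injective hΔ.ne'),
      Set.ncard_univ, Nat.card_fin]
  · rintro _ ⟨i, rfl⟩
    exact RLGen.admissible_gaussianBandit hΔ.le hΔ' i
  · rintro _ ⟨i, rfl⟩
    exact RLGen.uniformBandit_apply hΔ.ne' i
  · have hC : (RLGen.complexity (RLGen.uniformBandit m Δ) K : ℝ) ≤ m := by
      exact_mod_cast RLGen.complexity_uniformBandit_le hΔ.ne' K
    have hreg := Alg.sum_instanceRegret_gaussianBandit_ge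
      (Alg.infoLaw (RLGen.uniformBandit m Δ)) hΔ.le hm hgap
    calc 1 / 32 * min (√(RLGen.complexity (RLGen.uniformBandit m Δ) K * K)) (K : ℝ)
        ≤ 1 / 32 * min (√(m * K)) (K : ℝ) := by gcongr
      _ ≤ (m : ℝ)⁻¹ * (m * (Δ * K / 8)) := by
        rw [inv_mul_cancel_left₀ hm0.ne']
        linarith
      _ ≤ _ := by
        rw [RLGen.regret_uniformBandit hΔ.ne']
        gcongr
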